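/- A \emph{Euclidean Jordan algebra} (EJA) is a real Hilbert space $E$, possibly infinite-dimensional, with a bilinear, commutative, unital (not necessarily associative) product $*$ satisfying $(a*b)*(a*a)=a*(b*(a*a))$ and $\langle a*b,c\rangle=\langle b,a*c\rangle$ for all $a,b,c\in E$. An element is \emph{positive} if it is of the form $b*b$; $a\le c$ means that $c-a$ is positive; an \emph{effect} is an element $q$ with $0\le q\le 1$. A linear map $f\colon E\to F$ between EJAs is \emph{positive} if it maps positive elements to positive elements, and \emph{subunital} if $f(1)\le 1$. An idempotent is an element $p$ with $p*p=p$; it is \emph{atomic} if it is nonzero and no nonzero idempotent lies strictly below it; idempotents $p,p'$ are \emph{orthogonal} if $p*p'=0$. Put $Q_a(b)=2\,a*(a*b)-(a*a)*b$. For an idempotent $p$, the subspace $E_1(p)=Q_p(E)$ is an EJA with the product and inner product of $E$ and with unit $p$. \textbf{Proposition.} Let $q$ be an effect of an EJA $E$. Then $q$ can be written as $q=\sum_{i=1}^n\lambda_ip_i$ with $\lambda_i>0$ and pairwise orthogonal atomic idempotents $p_i$. With such a decomposition put $\lceil q\rceil=\sum_ip_i$, $\sqrt q=\sum_i\sqrt{\lambda_i}\,p_i$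 and $E_q=E_1(\lceil q\rceil)$, let $\iota\colon E_q\to E$ be the inclusion, and let $\xi_q=Q_{\sqrt q}\circ\iota\colon E_q\to E$. Then $\xi_q$ is a filter for $q$, that is: $\xi_q$ is a positive subunital linear map with $\xi_q(1)\le q$, and for every EJA $F$ and every positive subunital linear map $f\colon F\to E$ with $f(1)\le q$ there is a unique positive subunital linear map $\bar f\colon F\to E_q$ with $\xi_q\circ\bar f=f$. -/

import Mathlib

universe u v w

/-- A (unital, possibly infinite-dimensional) Euclidean Jordan algebra: a real Hilbert space with a
unital commutative bilinear product satisfying the Jordan identity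
`(a * b) * (a * a) = a * (b * (a * a))` (this is `IsCommJordan`) for which the multiplication
operators are symmetric with respect to the inner product. -/
class EuclideanJordanAlgebra (E : Type*) [NormedAddCommGroup E] [InnerProductSpace ℝ E] extends
    CommMagma E, MulOneClass E, IsCommJordan E, LeftDistribClass E, RightDistribClass E,
    SMulCommClass ℝ E E, IsScalarTower ℝ E E, CompleteSpace E where
  inner_mul_left : ∀ a b c : E, inner ℝ (a * b) c = inner ℝ b (a * c)

namespace EuclideanJordanAlgebra

section Basic

variable {E : Type*} [NormedAddCommGroup E] [InnerProductSpace ℝ E] [EuclideanJordanAlgebra E]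

/-- `a` is positive: it is a square. -/
def IsPos (a : E) : Prop := ∃ b : E, a = b * b

/-- The order `a ≤ c` of a Euclidean Jordan algebra: `c - a` is positive. -/
def JLe (a c : E) : Prop := IsPos (c - a)

/-- An effect: `0 ≤ a ≤ 1`. -/
def IsEffect (a : E) : Prop := JLe 0 a ∧ JLe a 1

/-- `p` is an idempotent. -/
def IsIdem (p : E) : Prop := p * p = p

/-- `p` is an atomic idempotent: nonzero, with no nonzero idempotent strictly below it. -/
def IsAtomicIdem (p : E) : Prop :=
  IsIdem p ∧ p ≠ 0 ∧ ∀ r : E, IsIdem r → r ≠ 0 → JLe r p → r = p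

/-- The multiplication operator `L a b = a * b`. -/
def L (a : E) : E →ₗ[ℝ] E where
  toFun b := a * b
  map_add' := mul_add a
  map_smul' r b := mul_smul_comm r a b

/-- The quadratic representation `Q a = 2 (L a)² - L (a²)`. -/
def Q (a : E) : E →ₗ[ℝ] E := (2 : ℝ) • (L a ∘ₗ L a) - L (a * a)

@[simp] theorem L_apply (a b : E) : L a b = a * b := rfl

theorem Q_apply (a b : E) : Q a b = (2 : ℝ) • (a * (a * b)) - a * a * b := rfl

/-- A decomposition `a = ∑ i, coef i • proj i` with positive coefficients and (pairwise) orthogonal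
atomic idempotents. -/
structure SpectralDecomposition (a : E) where
  n : ℕ
  coef : Fin n → ℝ
  proj : Fin n → E
  coef_pos : ∀ i, 0 < coef i
  atomic : ∀ i, IsAtomicIdem (proj i)
  orthogonal : ∀ i j, i ≠ j → proj i * proj j = 0
  sum_eq : a = ∑ i, coef i • proj i

open Classical in
/-- The ceiling `⌈a⌉ = ∑ i, p i` of `a = ∑ i, λ i • p i`
(zero if `a` has no such decomposition). -/
noncomputable def ceil (a : E) : E :=
  if h : Nonempty (SpectralDecomposition a) then ∑ i, h.some.proj i else 0

open Classical in
/-- The square root `√a = ∑ i, √(λ i) • p i` of `a = ∑ i, λ i • p i`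
(zero if `a` has no such decomposition). -/
noncomputable def sqrt (a : E) : E :=
  if h : Nonempty (SpectralDecomposition a) then ∑ i, Real.sqrt (h.some.coef i) • h.some.proj i
  else 0

theorem isIdem_ceil (a : E) : IsIdem (ceil a) := by
  unfold IsIdem ceil
  split_ifs with h
  · generalize h.some = d
    rw [← L_apply, map_sum]
    refine Finset.sum_congr rfl fun j _ => ?_
    rw [L_apply, mul_comm, ← L_apply, map_sum, Finset.sum_eq_single j]
    · exact (d.atomic j).1
    · intro i _ hij
      exact d.orthogonal j i hij.symm
    · simp
  · exact (L (0 : E)).map_zero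

/-- The Peirce one-space `E₁(p) = Q_p(E)`. -/
def peirceOne (p : E) : Submodule ℝ E := LinearMap.range (Q p)

/-- The nonassociative ring underlying a Euclidean Jordan algebra. -/
abbrev toRing (E : Type*) [NormedAddCommGroup E] [InnerProductSpace ℝ E]
    [EuclideanJordanAlgebra E] : NonUnitalNonAssocCommRing E where
  left_distrib := mul_add
  right_distrib := add_mul
  zero_mul a := by rw [mul_comm]; exact (L a).map_zero
  mul_zero a := (L a).map_zero
  mul_comm := mul_comm

/-- A partial linearization of the Jordan identity at an idempotent. -/
theorem jordan_idem {p : E} (hp : IsIdem p) (x y : E) :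
    x * (p * y) - p * (x * y) + (2 : ℝ) • (p * (p * x * y) - p * x * (p * y)) = 0 := by
  let _ := toRing E
  have _ : IsCommJordan E := ⟨EuclideanJordanAlgebra.toIsCommJordan.lmul_comm_rmul_rmul⟩
  have h := DFunLike.congr_fun (two_nsmul_lie_lmul_lmul_add_add_eq_zero x p p) y
  rw [show p * p = p from hp, mul_comm x p] at h
  replace h : (2 : ℕ) • ((x * (p * y) - p * (x * y)) + (p * (p * x * y) - p * x * (p * y))
      + (p * (p * x * y) - p * x * (p * y))) = 0 := h
  have h2 : (2 : ℝ) • (x * (p * y) - p * (x * y)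
      + (2 : ℝ) • (p * (p * x * y) - p * x * (p * y))) = 0 := by
    rw [← h]
    module
  exact (smul_eq_zero.mp h2).resolve_left two_ne_zero

/-- `E₁(p)` consists of the elements fixed by multiplication with the idempotent `p`. -/
theorem mem_peirceOne_iff {p : E} (hp : IsIdem p) (x : E) : x ∈ peirceOne p ↔ p * x = x := by
  have hpp : p * p = p := hp
  constructor
  · rintro ⟨a, rfl⟩
    have h := jordan_idem hp a p
    rw [hpp, mul_comm a p, mul_comm (p * a) p] at h
    rw [Q_apply, hpp, ← L_apply p (_ - _), map_sub, map_smul, L_apply, L_apply,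
      ← sub_eq_zero, ← h]
    module
  · intro h
    refine ⟨x, ?_⟩
    rw [Q_apply, hpp, h, h]
    module

theorem mul_mem_peirceOne {p : E} (hp : IsIdem p) {x y : E} (hx : x ∈ peirceOne p)
    (hy : y ∈ peirceOne p) : x * y ∈ peirceOne p := by
  rw [mem_peirceOne_iff hp] at *
  have h := jordan_idem hp x y
  rw [hx, hy, ← sub_eq_zero] at *
  rw [← h]
  module

theorem isClosed_peirceOne {p : E} (hp : IsIdem p) : IsClosed (peirceOne p : Set E) := by
  have hc : Continuous (L p) := LinearMap.IsSymmetric.continuous fun b c => inner_mul_left p b c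
  have : (peirceOne p : Set E) = {x | L p x = x} := by
    ext x
    exact mem_peirceOne_iff hp x
  rw [this]
  exact isClosed_eq hc continuous_id

/-- For an idempotent `p`, the space `E₁(p)` with the product and inner product of `E`
and with unit `p` is a Euclidean Jordan algebra. -/
@[reducible] def peirceOneAlgebra (p : E) (hp : IsIdem p) :
    EuclideanJordanAlgebra (peirceOne p) where
  mul x y := ⟨x * y, mul_mem_peirceOne hp x.2 y.2⟩
  one := ⟨p, (mem_peirceOne_iff hp p).2 hp⟩
  mul_comm x y := Subtype.ext (mul_comm (x : E) y)
  one_mul x := Subtype.ext ((mem_peirceOne_iff hp x).1 x.2)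
  mul_one x := Subtype.ext ((mul_comm (x : E) p).trans ((mem_peirceOne_iff hp x).1 x.2))
  lmul_comm_rmul_rmul x y := Subtype.ext (IsCommJordan.lmul_comm_rmul_rmul (x : E) y)
  left_distrib x y z := Subtype.ext (mul_add (x : E) y z)
  right_distrib x y z := Subtype.ext (add_mul (x : E) y z)
  smul_comm r x y := Subtype.ext (smul_comm r (x : E) (y : E))
  smul_assoc r x y := Subtype.ext (smul_assoc r (x : E) (y : E))
  complete := (isClosed_peirceOne hp).completeSpace_coe.complete
  inner_mul_left x y z := inner_mul_left (x : E) y z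

/-- The space `E_q = E₁(⌈q⌉)`. -/
noncomputable def filterSpace (q : E) : Submodule ℝ E := peirceOne (ceil q)

noncomputable instance (q : E) : EuclideanJordanAlgebra (filterSpace q) :=
  peirceOneAlgebra (ceil q) (isIdem_ceil q)

/-- The map `ξ_q = Q_{√q} ∘ ι` with `ι : E₁(⌈q⌉) → E` the inclusion. -/
noncomputable def standardFilter (q : E) : filterSpace q →ₗ[ℝ] E :=
  Q (sqrt q) ∘ₗ (filterSpace q).subtype

end Basic

/-- A linear map between Euclidean Jordan algebras is positive and subunital. -/
def IsPSU {E F : Type*} [NormedAddCommGroup E] [InnerProductSpace ℝ E] [EuclideanJordanAlgebra E]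
    [NormedAddCommGroup F] [InnerProductSpace ℝ F] [EuclideanJordanAlgebra F]
    (f : E →ₗ[ℝ] F) : Prop :=
  (∀ a, IsPos a → IsPos (f a)) ∧ JLe (f 1) 1

/-- `ξ : D → E` is a filter for the effect `q` of `E`: it is a positive subunital linear map with
`ξ(1) ≤ q`, and it is final among these, with test algebras `F` ranging over the universe `w`. -/
def IsFilterFor {E : Type u} {D : Type v}
    [NormedAddCommGroup E] [InnerProductSpace ℝ E] [EuclideanJordanAlgebra E]
    [NormedAddCommGroup D] [InnerProductSpace ℝ D] [EuclideanJordanAlgebra D]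
    (q : E) (ξ : D →ₗ[ℝ] E) : Prop :=
  IsPSU ξ ∧ JLe (ξ 1) q ∧
    ∀ (F : Type w) [NormedAddCommGroup F] [InnerProductSpace ℝ F] [EuclideanJordanAlgebra F]
      (f : F →ₗ[ℝ] E), IsPSU f → JLe (f 1) q →
        ∃! g : F →ₗ[ℝ] D, IsPSU g ∧ ξ ∘ₗ g = f

end EuclideanJordanAlgebra

/-! The element `√q` is invertible inside `E_q`, so `ξ_q` restricts to an order automorphism of
`E_q` that sends the unit to `q`. Its inverse is `Q B` with `B = ∑ i, (√λ i)⁻¹ • p i`. If `f 1 ≤ q`,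
then `f` takes values in `E_q`, and `Q B ∘ f` is the only possible factorization.

Two facts carry this. The first is a finite spectral theorem without assuming finite dimension
(`exists_spectral_decomposition`). The product is bounded, so nonzero idempotents have norm bounded
below. Hence splitting off orthogonal idempotents must stop, and each step needs only one idempotent
eigenvector (`exists_eigen_idem`). A consequence is `isPos_iff`: positivity can be tested against
idempotents.

The second is positivity of `Q a` for `a = ∑ a i • p i` with `a i > 0` (`Q_one_add_sum`), obtained
without the fundamental formula. `Q` factors over the orthogonal `p i`, and each factor `Q (1 + t •
p)` is `exp (2 log (1 + t) L p)`, a limit of powers of positive resolvents. -/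

namespace EuclideanJordanAlgebra

/-! ### Peirce calculus of one idempotent -/

section Algebra

variable {E : Type*} [NormedAddCommGroup E] [InnerProductSpace ℝ E] [EuclideanJordanAlgebra E]

theorem jmul_zero (a : E) : a * 0 = 0 := (L a).map_zero

theorem jzero_mul (a : E) : 0 * a = 0 := by rw [mul_comm]; exact jmul_zero a

theorem jmul_sub (a b c : E) : a * (b - c) = a * b - a * c := (L a).map_sub b c

theorem jsub_mul (a b c : E) : (a - b) * c = a * c - b * c := by
  rw [mul_comm, jmul_sub, mul_comm c, mul_comm c]

theorem jmul_sum {ι : Type*} (s : Finset ι) (f : ι → E) (a : E) :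
    a * ∑ i ∈ s, f i = ∑ i ∈ s, a * f i := map_sum (L a) f s

/-- The full linearization of the Jordan identity. -/
theorem jordan_linearized (a b c d : E) :
    a * (b * c * d) - b * c * (a * d) + (b * (c * a * d) - c * a * (b * d))
      + (c * (a * b * d) - a * b * (c * d)) = 0 := by
  let _ := toRing E
  have _ : IsCommJordan E := ⟨EuclideanJordanAlgebra.toIsCommJordan.lmul_comm_rmul_rmul⟩
  have h := DFunLike.congr_fun (two_nsmul_lie_lmul_lmul_add_add_eq_zero a b c) d
  replace h : (2 : ℕ) • (a * (b * c * d) - b * c * (a * d) + (b * (c * a * d) - c * a * (b * d))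
      + (c * (a * b * d) - a * b * (c * d))) = 0 := h
  rw [← Nat.cast_smul_eq_nsmul ℝ] at h
  exact (smul_eq_zero.mp h).resolve_left (by norm_num)

theorem inner_mul_comm (a b c : E) : inner ℝ (a * b) c = inner ℝ a (b * c) := by
  rw [mul_comm, inner_mul_left]

theorem isIdem_one_sub {p : E} (hp : IsIdem p) : IsIdem (1 - p) := by
  have h : p * p = p := hp
  unfold IsIdem
  simp only [jmul_sub, jsub_mul, mul_one, one_mul, h]
  abel

theorem isIdem_sub {p u : E} (hp : IsIdem p) (hu : IsIdem u) (h : p * u = u) :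
    IsIdem (p - u) := by
  have h1 : p * p = p := hp
  have h2 : u * u = u := hu
  unfold IsIdem
  simp only [jmul_sub, jsub_mul, mul_comm u p, h1, h2, h]
  abel

/-- The linearized Jordan identity, used with `x` and `y` in both orders, gives `p * (x * y) = 0`
and `p * (x * y) = x * y`. -/
theorem mul_eq_zero_of_peirce {p x y : E} (hp : IsIdem p) (hx : p * x = x) (hy : p * y = 0) :
    x * y = 0 := by
  have h1 := jordan_idem hp x y
  have h2 := jordan_idem hp y x
  rw [hx, hy, jmul_zero] at h1
  rw [hx, hy, jzero_mul, jmul_zero, mul_comm y x] at h2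
  have h3 : p * (x * y) = 0 := by rw [← h1]; module
  rw [h3] at h2
  simpa using h2

/-- This is `2L³ - 3L² + L = 0` for `L = L p`: the only possible eigenvalues are `0`, `1/2` and `1`.
-/
theorem mul_mul_idem {p : E} (hp : IsIdem p) (x : E) :
    p * (p * (p * x)) = (3 / 2 : ℝ) • (p * (p * x)) - (1 / 2 : ℝ) • (p * x) := by
  have h := jordan_linearized p p x p
  have h1 : p * p = p := hp
  simp only [h1, mul_comm x p, mul_comm _ p] at h
  have : (2 : ℝ) • (p * (p * (p * x))) = (3 : ℝ) • (p * (p * x)) - p * x := by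
    rw [← sub_eq_zero]
    refine Eq.trans ?_ h
    module
  rw [← smul_right_injective E (two_ne_zero' ℝ) |>.eq_iff, this]
  module

/-- The scalar identity `λ = λ² + 4(λ - λ²)²` holds at `0`, `1/2` and `1`. It exhibits `L p` as a
positive operator. -/
theorem inner_idem_mul {p : E} (hp : IsIdem p) (x : E) :
    inner ℝ (p * x) x = ‖p * x‖ ^ 2 + 4 * ‖p * x - p * (p * x)‖ ^ 2 := by
  have h3 := mul_mul_idem hp x
  have e : ∀ y, inner ℝ (p * y) x = inner ℝ y (p * x) := fun y => inner_mul_left p y x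
  rw [← real_inner_self_eq_norm_sq, ← real_inner_self_eq_norm_sq]
  have h4 : inner ℝ (p * (p * (p * (p * x)))) x
      = (7 / 4 : ℝ) * inner ℝ (p * (p * x)) x - (3 / 4 : ℝ) * inner ℝ (p * x) x := by
    rw [mul_mul_idem hp (p * x), h3]
    simp only [inner_sub_left, inner_smul_left, RCLike.conj_to_real]
    ring
  have h5 : inner ℝ (p * (p * (p * x))) x
      = (3 / 2 : ℝ) * inner ℝ (p * (p * x)) x - (1 / 2 : ℝ) * inner ℝ (p * x) x := by
    rw [h3]
    simp only [inner_sub_left, inner_smul_left, RCLike.conj_to_real]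
  have e2 : inner ℝ (p * x) (p * x) = inner ℝ (p * (p * x)) x := (e _).symm
  have e3 : inner ℝ (p * x) (p * (p * x)) = inner ℝ (p * (p * (p * x))) x := by
    rw [e (p * (p * x)), real_inner_comm]
  have e4 : inner ℝ (p * (p * x)) (p * (p * x)) = inner ℝ (p * (p * (p * (p * x)))) x := by
    rw [e, inner_mul_left p (p * (p * x)) (p * x)]
  simp only [inner_sub_left, inner_sub_right]
  rw [real_inner_comm (p * x) (p * (p * x)), e2, e3, e4, h4, h5]
  ring

theorem inner_sq_idem_nonneg {u : E} (hu : IsIdem u) (b : E) : 0 ≤ inner ℝ (b * b) u := by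
  rw [inner_mul_left, real_inner_comm, mul_comm, inner_idem_mul hu]
  positivity

theorem IsPos.inner_idem_nonneg {a u : E} (ha : IsPos a) (hu : IsIdem u) : 0 ≤ inner ℝ a u := by
  obtain ⟨b, rfl⟩ := ha
  exact inner_sq_idem_nonneg hu b

theorem IsIdem.isPos {p : E} (hp : IsIdem p) : IsPos p := ⟨p, hp.symm⟩

/-- A positive element orthogonal to an idempotent annihilates it. -/
theorem IsPos.mul_eq_zero {a u : E} (ha : IsPos a) (hu : IsIdem u) (h : inner ℝ a u ≤ 0) :
    u * a = 0 := by
  obtain ⟨b, rfl⟩ := ha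
  have hb : u * b = 0 := by
    rw [inner_mul_left, real_inner_comm, mul_comm b u, inner_idem_mul hu] at h
    rw [← norm_eq_zero, ← sq_eq_zero_iff]
    nlinarith [sq_nonneg ‖u * b‖, sq_nonneg ‖u * b - u * (u * b)‖]
  -- The Peirce zero-space of `u` is `E₁(1 - u)`, which is closed under products.
  have hv := isIdem_one_sub hu
  have hb' : b ∈ peirceOne (1 - u) := by
    rw [mem_peirceOne_iff hv, jsub_mul, one_mul, hb, sub_zero]
  have := (mem_peirceOne_iff hv _).1 (mul_mem_peirceOne hv hb' hb')
  rw [jsub_mul, one_mul] at this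
  simpa using this

theorem inner_eq_zero_of_mul_eq_zero {a b : E} (h : a * b = 0) : inner ℝ a b = 0 := by
  rw [← mul_one a, inner_mul_left, h, inner_zero_right]

/-- Pairing `p - r ≥ 0` with `1 - p` gives `⟪r, 1 - p⟫ ≤ 0`, so `1 - p` annihilates `r`. -/
theorem mul_eq_of_jLe {r p : E} (hr : IsPos r) (hp : IsIdem p) (h : JLe r p) : p * r = r := by
  have hv := isIdem_one_sub hp
  have h1 := h.inner_idem_nonneg hv
  have hpp : p * p = p := hp
  have h2 : inner ℝ p (1 - p) = 0 := by
    exact inner_eq_zero_of_mul_eq_zero (by rw [jmul_sub, mul_one, hpp, sub_self])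
  rw [inner_sub_left, h2] at h1
  have := hr.mul_eq_zero hv (by linarith)
  rw [jsub_mul, one_mul, sub_eq_zero] at this
  exact this.symm

theorem norm_sq_sub_idem {p u : E} (hu : IsIdem u) (h : p * u = u) :
    ‖p‖ ^ 2 = ‖p - u‖ ^ 2 + ‖u‖ ^ 2 := by
  have h2 : u * u = u := hu
  have h1 : inner ℝ (p - u) u = 0 :=
    inner_eq_zero_of_mul_eq_zero (by rw [jsub_mul, h, h2, sub_self])
  have := norm_add_sq_real (p - u) u
  rw [sub_add_cancel, h1] at this
  linarith

end Algebra

/-! ### Boundedness of the product -/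

section Norm

variable {E : Type*} [NormedAddCommGroup E] [InnerProductSpace ℝ E] [EuclideanJordanAlgebra E]

theorem continuous_mul_left_fixed (a : E) : Continuous fun b : E => a * b :=
  LinearMap.IsSymmetric.continuous (T := L a) fun b c => inner_mul_left a b c

variable (E) in
-- Each `L a` is continuous because it is symmetric (Hellinger–Toeplitz). Commutativity bounds the
-- family over the unit ball pointwise, and uniform boundedness applies.
theorem exists_norm_mul_le : ∃ C : ℝ, 0 < C ∧ ∀ a b : E, ‖a * b‖ ≤ C * ‖a‖ * ‖b‖ := by
  let T : E → E →L[ℝ] E := fun a => ⟨L a, continuous_mul_left_fixed a⟩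
  have hT : ∀ a b, T a b = a * b := fun a b => rfl
  obtain ⟨C, hC⟩ := banach_steinhaus (g := fun a : Metric.closedBall (0 : E) 1 => T a) fun b =>
    ⟨‖T b‖, fun a => by
      rw [hT, mul_comm, ← hT]
      refine ((T b).le_opNorm _).trans ?_
      have : ‖(a : E)‖ ≤ 1 := mem_closedBall_zero_iff.1 a.2
      exact mul_le_of_le_one_right (norm_nonneg _) this⟩
  refine ⟨max C 1, by positivity, fun a b => ?_⟩
  rcases eq_or_ne a 0 with rfl | ha
  · simp [jzero_mul]
  have ha' : 0 < ‖a‖ := norm_pos_iff.2 ha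
  have h1 : ‖‖a‖⁻¹ • a‖ ≤ 1 := by
    rw [norm_smul, norm_inv, norm_norm, inv_mul_cancel₀ ha'.ne']
  have h2 := (T (‖a‖⁻¹ • a)).le_of_opNorm_le (hC ⟨‖a‖⁻¹ • a, mem_closedBall_zero_iff.2 h1⟩) b
  rw [hT, smul_mul_assoc, norm_smul, norm_inv, norm_norm, inv_mul_le_iff₀ ha'] at h2
  calc ‖a * b‖ ≤ ‖a‖ * (C * ‖b‖) := h2
    _ ≤ ‖a‖ * (max C 1 * ‖b‖) := by gcongr; exact le_max_left _ _
    _ = _ := by ring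

variable (E) in
-- From `‖p‖ = ‖p * p‖ ≤ C‖p‖²`. With Pythagoras, this gap `δ` is the finiteness principle replacing
-- finite dimension.
theorem exists_le_norm_sq_idem :
    ∃ δ : ℝ, 0 < δ ∧ ∀ p : E, IsIdem p → p ≠ 0 → δ ≤ ‖p‖ ^ 2 := by
  obtain ⟨C, hC, h⟩ := exists_norm_mul_le E
  refine ⟨(C⁻¹) ^ 2, by positivity, fun p hp hp0 => ?_⟩
  have h0 : 0 < ‖p‖ := norm_pos_iff.2 hp0
  have h1 := h p p
  rw [show p * p = p from hp] at h1
  have : C⁻¹ ≤ ‖p‖ := by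
    rw [inv_le_iff_one_le_mul₀ hC]
    nlinarith
  gcongr

end Norm

/-! ### Power associativity and the closed algebra generated by one element -/

section Power

variable {E : Type*} [NormedAddCommGroup E] [InnerProductSpace ℝ E] [EuclideanJordanAlgebra E]

/-- The power `a ^ n`, as an iterated multiplication by `a`. -/
def jpow (a : E) : ℕ → E
  | 0 => 1
  | n + 1 => a * jpow a n

theorem jordan_self (a z : E) : a * a * (a * z) = a * (a * a * z) := by
  have h := jordan_linearized a a a z
  rw [← sub_eq_zero, ← smul_right_injective E (show (-3 : ℝ) ≠ 0 by norm_num) |>.eq_iff,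
    smul_zero, ← h]
  module

theorem jpow_mul_comm (a : E) (n : ℕ) : ∀ z, jpow a n * (a * z) = a * (jpow a n * z) := by
  induction n using Nat.strong_induction_on with
  | _ n ih =>
    match n with
    | 0 => intro z; simp [jpow]
    | 1 => intro z; simp [jpow]
    | n + 2 =>
      have h0 := ih n (by omega)
      have h1 := ih (n + 1) (by omega)
      -- Recursion expressing `L (aⁿ⁺²)` through operators that already commute with `L a`.
      have key : ∀ d, jpow a (n + 2) * d = (2 : ℝ) • (a * (jpow a (n + 1) * d))
          + a * a * (jpow a n * d) - a * (a * (jpow a n * d)) - a * (a * (jpow a n * d)) := by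
        intro d
        have h := jordan_linearized a (jpow a n) d a
        rw [mul_comm _ a, mul_comm (d * a) a, mul_comm d a, mul_comm (jpow a n * d) (a * a),
          mul_comm (a * d) (jpow a n * a), mul_comm (jpow a n) a, mul_comm d,
          mul_comm (a * jpow a n) a] at h
        change _ + (_ - jpow a (n + 1) * _) + (jpow a (n + 2) * _ - jpow a (n + 1) * _) = 0 at h
        rw [h0, h0, h1] at h
        rw [← sub_eq_zero, ← h]
        module
      intro z
      rw [key, key, h0, h1, jordan_self]
      simp only [jmul_sub, mul_add, mul_smul_comm]

theorem jpow_mul_jpow (a : E) (m n : ℕ) : jpow a m * jpow a n = jpow a (m + n) := by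
  induction n with
  | zero => simp [jpow]
  | succ n ih => rw [jpow, jpow_mul_comm, ih]; rfl

/-- The closed subspace spanned by the powers of `a`. -/
def closedPowers (a : E) : Submodule ℝ E :=
  (Submodule.span ℝ (Set.range (jpow a))).topologicalClosure

theorem isClosed_closedPowers (a : E) : IsClosed (closedPowers a : Set E) :=
  Submodule.isClosed_topologicalClosure _

theorem closedPowers_induction (a : E) (V : Submodule ℝ E) (hV : IsClosed (V : Set E))
    (h : ∀ n, jpow a n ∈ V) {x : E} (hx : x ∈ closedPowers a) : x ∈ V :=
  Submodule.topologicalClosure_minimal _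
    (Submodule.span_le.2 (by rintro _ ⟨n, rfl⟩; exact h n)) hV hx

theorem jpow_mem (a : E) (n : ℕ) : jpow a n ∈ closedPowers a :=
  Submodule.le_topologicalClosure _ (Submodule.subset_span ⟨n, rfl⟩)

theorem one_mem_closedPowers (a : E) : (1 : E) ∈ closedPowers a := jpow_mem a 0

theorem mul_mem_closedPowers {a x y : E} (hx : x ∈ closedPowers a) (hy : y ∈ closedPowers a) :
    x * y ∈ closedPowers a := by
  refine closedPowers_induction a ((closedPowers a).comap (L x))
    ((isClosed_closedPowers a).preimage (continuous_mul_left_fixed x)) (fun n => ?_) hy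
  change x * jpow a n ∈ closedPowers a
  rw [mul_comm]
  refine closedPowers_induction a ((closedPowers a).comap (L (jpow a n)))
    ((isClosed_closedPowers a).preimage (continuous_mul_left_fixed _)) (fun m => ?_) hx
  change jpow a n * jpow a m ∈ closedPowers a
  rw [jpow_mul_jpow]
  exact jpow_mem a _

theorem self_mul_mem_closedPowers {a x : E} (hx : x ∈ closedPowers a) :
    a * x ∈ closedPowers a :=
  mul_mem_closedPowers (by simpa [jpow] using jpow_mem a 1) hx

theorem closedPowers_mul_comm {a x : E} (hx : x ∈ closedPowers a) (z : E) :
    x * (a * z) = a * (x * z) := by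
  have := closedPowers_induction a
    (LinearMap.ker (L (a * z) - L a ∘ₗ L z)) (by
      have : (LinearMap.ker (L (a * z) - L a ∘ₗ L z) : Set E)
          = {x | a * z * x = a * (z * x)} := by
        ext x; simp [sub_eq_zero]
      rw [this]
      exact isClosed_eq (continuous_mul_left_fixed _)
        ((continuous_mul_left_fixed a).comp (continuous_mul_left_fixed z)))
    (fun n => by
      simp [mul_comm _ (jpow a n), jpow_mul_comm]) hx
  simpa [sub_eq_zero, mul_comm _ x] using this

end Power

/-! ### Existence of an idempotent eigenvector -/

section Eigen

variable {E : Type*} [NormedAddCommGroup E] [InnerProductSpace ℝ E] [EuclideanJordanAlgebra E]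

/-- The top of the spectrum of `a` on the closed span of its powers is an approximate eigenvalue. -/
theorem exists_approx_eigenvalue (a : E) (h1 : (1 : E) ≠ 0) :
    ∃ r : ℝ, ∀ ε > 0, ∃ y ∈ closedPowers a, ‖y‖ = 1 ∧ ‖a * y - r • y‖ < ε := by
  obtain ⟨C, hC, hmul⟩ := exists_norm_mul_le E
  set S : Set ℝ := (fun y => inner ℝ (a * y) y) '' {y | y ∈ closedPowers a ∧ ‖y‖ = 1} with hS
  have hbd : BddAbove S := by
    refine ⟨C * ‖a‖, ?_⟩
    rintro _ ⟨y, ⟨-, hy⟩, rfl⟩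
    have := (real_inner_le_norm (a * y) y).trans
      (mul_le_mul_of_nonneg_right (hmul a y) (norm_nonneg y))
    simpa [hy] using this
  have hne : S.Nonempty := by
    refine ⟨_, ‖(1 : E)‖⁻¹ • 1, ⟨Submodule.smul_mem _ _ (one_mem_closedPowers a), ?_⟩, rfl⟩
    rw [norm_smul, norm_inv, norm_norm, inv_mul_cancel₀ (norm_ne_zero_iff.2 h1)]
  set r := sSup S with hr
  have hle : ∀ y ∈ closedPowers a, inner ℝ (a * y) y ≤ r * ‖y‖ ^ 2 := by
    intro y hy
    rcases eq_or_ne y 0 with rfl | hy0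
    · simp
    have hn : ‖y‖ ≠ 0 := norm_ne_zero_iff.2 hy0
    have := le_csSup hbd ⟨‖y‖⁻¹ • y, ⟨Submodule.smul_mem _ _ hy, by
      rw [norm_smul, norm_inv, norm_norm, inv_mul_cancel₀ hn]⟩, rfl⟩
    simp only [mul_smul_comm, inner_smul_left, inner_smul_right, RCLike.conj_to_real] at this
    have hp : 0 < ‖y‖ ^ 2 := by positivity
    rw [← div_le_iff₀ hp]
    refine le_trans (le_of_eq ?_) this
    field_simp
  -- `D` bounds the operator `A = r - L a`; the `+ 1` keeps it positive.
  set D : ℝ := |r| + C * ‖a‖ + 1 with hD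
  have hDpos : 0 < D := by positivity
  refine ⟨r, fun ε hε => ?_⟩
  obtain ⟨_, ⟨y, ⟨hy, hy1⟩, rfl⟩, hlt⟩ :=
    exists_lt_of_lt_csSup hne (show r - ε ^ 2 / D < sSup S by
      have : 0 < ε ^ 2 / D := by positivity
      linarith)
  refine ⟨y, hy, hy1, ?_⟩
  set z := r • y - a * y with hz
  have hzmem : z ∈ closedPowers a :=
    Submodule.sub_mem _ (Submodule.smul_mem _ _ hy) (self_mul_mem_closedPowers hy)
  have hsymm : inner ℝ (a * z) y = inner ℝ z (a * y) := inner_mul_left a z y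
  have hzz : r * ‖z‖ ^ 2 - inner ℝ (a * z) z ≤ D * ‖z‖ ^ 2 := by
    have h1 := abs_le.1 ((abs_real_inner_le_norm (a * z) z).trans
      (mul_le_mul_of_nonneg_right (hmul a z) (norm_nonneg z)))
    have h2 := le_abs_self r
    nlinarith [sq_nonneg ‖z‖]
  have hyz : r * inner ℝ y z - inner ℝ (a * y) z = ‖z‖ ^ 2 := by
    rw [← real_inner_self_eq_norm_sq]
    conv_rhs => rw [hz]
    rw [inner_sub_left, inner_smul_left]
    rfl
  -- A gradient step: since `⟪A v, v⟫ ≥ 0` on the closed span, the choice `v = y - D⁻¹ • A y` yields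
  -- `‖A y‖² ≤ D ⟪A y, y⟫`.
  have hq := hle (y - D⁻¹ • z) (Submodule.sub_mem _ hy (Submodule.smul_mem _ _ hzmem))
  rw [← real_inner_self_eq_norm_sq] at hq
  simp only [jmul_sub, mul_smul_comm, inner_sub_left, inner_sub_right, inner_smul_left,
    inner_smul_right, RCLike.conj_to_real] at hq
  rw [real_inner_comm y z] at hq
  rw [hsymm, real_inner_comm (a * y) z, real_inner_self_eq_norm_sq y, hy1] at hq
  rw [real_inner_self_eq_norm_sq z] at hq
  rw [norm_sub_rev, ← abs_of_pos hε, ← abs_norm, ← sq_lt_sq, ← hz]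
  have hlt' : r - inner ℝ (a * y) y < ε ^ 2 / D := by linarith
  have hDD : D * D⁻¹ = 1 := mul_inv_cancel₀ hDpos.ne'
  have hDi : 0 < D⁻¹ := inv_pos.2 hDpos
  have h3 : D⁻¹ * ‖z‖ ^ 2 ≤ r - inner ℝ (a * y) y := by
    have h4 : D⁻¹ * (D⁻¹ * (r * ‖z‖ ^ 2 - inner ℝ (a * z) z)) ≤ D⁻¹ * ‖z‖ ^ 2 := by
      gcongr
      calc _ ≤ D⁻¹ * (D * ‖z‖ ^ 2) := by gcongr
        _ = ‖z‖ ^ 2 := by rw [← mul_assoc, mul_comm D⁻¹, hDD, one_mul]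
    linear_combination hq + h4 - 2 * D⁻¹ * hyz
  rw [div_eq_inv_mul] at hlt'
  exact lt_of_mul_lt_mul_left (h3.trans_lt hlt') hDi.le

/-- Every element of a nonzero Euclidean Jordan algebra has an idempotent eigenvector. -/
theorem exists_eigen_idem (a : E) (h1 : (1 : E) ≠ 0) :
    ∃ (r : ℝ) (e : E), IsIdem e ∧ e ≠ 0 ∧ a * e = r • e := by
  obtain ⟨C, hC, hmul⟩ := exists_norm_mul_le E
  obtain ⟨r, hr⟩ := exists_approx_eigenvalue a h1
  set K := closedPowers a with hK
  set T : E →ₗ[ℝ] E := L a - r • LinearMap.id with hT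
  have hTa : ∀ x, T x = a * x - r • x := fun x => rfl
  have hTK : ∀ x ∈ K, T x ∈ K := fun x hx =>
    Submodule.sub_mem _ (self_mul_mem_closedPowers hx) (Submodule.smul_mem _ _ hx)
  have hTsymm : ∀ x y, inner ℝ (T x) y = inner ℝ x (T y) := by
    intro x y
    rw [hTa, hTa, inner_sub_left, inner_sub_right, inner_mul_left, inner_smul_left,
      inner_smul_right]
    rfl
  have hTmul : ∀ x ∈ K, ∀ y, T (x * y) = x * T y := by
    intro x hx y
    rw [hTa, hTa, jmul_sub, mul_smul_comm, closedPowers_mul_comm hx]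
  set M := (K.map T).topologicalClosure with hM
  have hMK : M ≤ K := Submodule.topologicalClosure_minimal _
    (by rintro _ ⟨x, hx, rfl⟩; exact hTK x hx) (isClosed_closedPowers a)
  have : CompleteSpace E := EuclideanJordanAlgebra.toCompleteSpace
  have : CompleteSpace M := (Submodule.isClosed_topologicalClosure _).completeSpace_coe
  -- `e` is the component of the unit orthogonal to the closed range of `T` on `K`; by symmetry it
  -- is an eigenvector.
  obtain ⟨m, hm, e, he, hsum⟩ := M.exists_add_mem_mem_orthogonal (1 : E)
  have heK : e ∈ K := by
    rw [show e = 1 - m by rw [hsum]; abel]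
    exact Submodule.sub_mem _ (one_mem_closedPowers a) (hMK hm)
  have hTM : ∀ x ∈ K, T x ∈ M := fun x hx =>
    Submodule.le_topologicalClosure _ ⟨x, hx, rfl⟩
  have hTe : T e = 0 := by
    rw [← inner_self_eq_zero (𝕜 := ℝ), hTsymm, real_inner_comm]
    exact he _ (hTM _ (hTK _ heK))
  have hker : ∀ x ∈ M, ∀ y, T y = 0 → inner ℝ x y = 0 := by
    intro x hx y hTy
    rw [← Submodule.mem_orthogonal_singleton_iff_inner_left (𝕜 := ℝ)]
    refine Submodule.topologicalClosure_minimal _ ?_ (Submodule.isClosed_orthogonal _) hx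
    rintro _ ⟨v, -, rfl⟩
    rw [Submodule.mem_orthogonal_singleton_iff_inner_left, hTsymm, hTy, inner_zero_right]
  have hee : e * e ∈ K := mul_mem_closedPowers heK heK
  have hTee : T (e * e) = 0 := by rw [hTmul e heK, hTe, jmul_zero]
  have hidem : IsIdem e := by
    unfold IsIdem
    rw [← sub_eq_zero, ← inner_self_eq_zero (𝕜 := ℝ)]
    set x := e * e - e with hx
    have hxK : x ∈ K := Submodule.sub_mem _ hee heK
    have hTx : T x = 0 := by rw [hx, map_sub, hTee, hTe, sub_zero]
    have hTex : T (e * x) = 0 := by rw [hTmul e heK, hTx, jmul_zero]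
    -- With `1 = m + e`, this gives `⟪x, x⟫ = ⟪e, e * x⟫ - ⟪1, e * x⟫ = -⟪m, e * x⟫ = 0`.
    have h2 := hker m hm (e * x) hTex
    have h3 : inner ℝ (1 : E) (e * x) = inner ℝ e x := by
      rw [← inner_mul_left, mul_one]
    nth_rewrite 1 [hx]
    rw [inner_sub_left, inner_mul_left, ← h3, hsum, inner_add_left, h2]
    ring
  refine ⟨r, e, hidem, ?_, sub_eq_zero.1 hTe⟩
  -- If `e = 0`, then `1` is close to some `T y`, so a unit approximate eigenvector `w` is close to
  -- `T y * w = y * T w`, which is small. The two tolerances make both errors at most `1/2`, one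
  -- strictly.
  rintro rfl
  rw [add_zero] at hsum
  have h1M : (1 : E) ∈ closure (K.map T : Set E) := by
    rw [hsum]; exact hm
  obtain ⟨_, ⟨y, hy, rfl⟩, hlt⟩ := Metric.mem_closure_iff.1 h1M (1 / (2 * C)) (by positivity)
  rw [dist_eq_norm] at hlt
  obtain ⟨w, hw, hw1, hTw⟩ := hr (1 / (2 * C * (‖y‖ + 1))) (by positivity)
  have hdec : w = (1 - T y) * w + y * T w := by
    rw [jsub_mul, one_mul, mul_comm (T y), ← hTmul w hw, mul_comm w y, hTmul y hy]
    abel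
  have h5 := norm_add_le ((1 - T y) * w) (y * T w)
  rw [← hdec, hw1] at h5
  have h6 := hmul (1 - T y) w
  have h7 := hmul y (T w)
  rw [hw1, mul_one] at h6
  have h8 : C * ‖1 - T y‖ < 1 / 2 := by
    calc C * ‖1 - T y‖ < C * (1 / (2 * C)) := by gcongr
      _ = 1 / 2 := by field_simp
  have h9 : C * ‖y‖ * ‖T w‖ ≤ 1 / 2 := by
    calc C * ‖y‖ * ‖T w‖ ≤ C * (‖y‖ + 1) * (1 / (2 * C * (‖y‖ + 1))) := by
          gcongr
          · linarith
          · exact hTw.le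
      _ = 1 / 2 := by field_simp
  linarith

end Eigen

/-! ### Finite spectral decomposition and the order -/

section Spectral

variable {E : Type*} [NormedAddCommGroup E] [InnerProductSpace ℝ E] [EuclideanJordanAlgebra E]

theorem exists_eigen_idem_peirceOne {p a : E} (hp : IsIdem p) (hp0 : p ≠ 0) (ha : p * a = a) :
    ∃ (r : ℝ) (e : E), IsIdem e ∧ e ≠ 0 ∧ p * e = e ∧ a * e = r • e := by
  let _ := peirceOneAlgebra p hp
  obtain ⟨r, e, he, he0, hae⟩ := exists_eigen_idem
    (⟨a, (mem_peirceOne_iff hp a).2 ha⟩ : peirceOne p) (fun h => hp0 (congrArg Subtype.val h))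
  exact ⟨r, e, congrArg Subtype.val he, fun h => he0 (Subtype.ext h),
    (mem_peirceOne_iff hp _).1 e.2, congrArg Subtype.val hae⟩

/-- `p - e` lies in the Peirce zero-space of `e`, hence annihilates `x`. -/
theorem mul_eq_of_mul_eq {p e x : E} (he : IsIdem e) (hpe : p * e = e) (hx : e * x = x) :
    p * x = x := by
  have he' : e * e = e := he
  have h := mul_eq_zero_of_peirce he hx (y := p - e)
    (by rw [jmul_sub, mul_comm e p, hpe, he', sub_self])
  rwa [mul_comm, jsub_mul, hx, sub_eq_zero] at h

theorem exists_atomic_below {e : E} (he : IsIdem e) (he0 : e ≠ 0) :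
    ∃ u, IsAtomicIdem u ∧ e * u = u := by
  obtain ⟨δ, hδ, hle⟩ := exists_le_norm_sq_idem E
  -- Passing to a strictly smaller idempotent lowers `‖e‖²` by at least `δ`, so `n` bounds the
  -- descent.
  suffices H : ∀ (n : ℕ) (e : E), ‖e‖ ^ 2 ≤ n * δ → IsIdem e → e ≠ 0 →
      ∃ u, IsAtomicIdem u ∧ e * u = u by
    obtain ⟨n, hn⟩ := exists_nat_ge (‖e‖ ^ 2 / δ)
    exact H n e ((div_le_iff₀ hδ).1 hn) he he0
  clear he he0 e
  intro n
  induction n with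
  | zero =>
    intro e hn he he0
    have := hle e he he0
    simp only [Nat.cast_zero, zero_mul] at hn
    linarith
  | succ n ih =>
    intro e hn he he0
    by_cases hat : IsAtomicIdem e
    · exact ⟨e, hat, he⟩
    · have : ∃ r : E, IsIdem r ∧ r ≠ 0 ∧ JLe r e ∧ r ≠ e := by
        by_contra! hcon
        exact hat ⟨he, he0, hcon⟩
      obtain ⟨r, hr, hr0, hre, hne⟩ := this
      have her := mul_eq_of_jLe hr.isPos he hre
      have h1 := norm_sq_sub_idem hr her
      have h2 := hle _ (isIdem_sub he hr her) (sub_ne_zero.2 hne.symm)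
      push_cast at hn
      obtain ⟨u, hu, hru⟩ := ih r (by linarith) hr hr0
      exact ⟨u, hu, mul_eq_of_mul_eq hr her hru⟩

theorem exists_eigen_atomic {p a : E} (hp : IsIdem p) (hp0 : p ≠ 0) (ha : p * a = a) :
    ∃ (r : ℝ) (u : E), IsAtomicIdem u ∧ p * u = u ∧ a * u = r • u := by
  obtain ⟨r, e, he, he0, hpe, hae⟩ := exists_eigen_idem_peirceOne hp hp0 ha
  obtain ⟨u, hu, heu⟩ := exists_atomic_below he he0
  refine ⟨r, u, hu, mul_eq_of_mul_eq he hpe heu, ?_⟩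
  have he' : e * e = e := he
  -- `e` annihilates `a - r • e`, so the atom `u` below `e` does too and inherits the eigenvalue.
  have h := mul_eq_zero_of_peirce he heu (y := a - r • e)
    (by rw [jmul_sub, mul_comm e a, hae, mul_smul_comm, he', sub_self])
  rwa [mul_comm, jsub_mul, smul_mul_assoc, heu, sub_eq_zero] at h

theorem exists_spectral_decomposition (a : E) :
    ∃ (s : Finset E) (c : E → ℝ), (∀ u ∈ s, IsAtomicIdem u) ∧
      (∀ u ∈ s, ∀ v ∈ s, u ≠ v → u * v = 0) ∧ a = ∑ u ∈ s, c u • u := by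
  classical
  obtain ⟨δ, hδ, hle⟩ := exists_le_norm_sq_idem E
  -- `p` is the unit of the corner still to be decomposed; each atomic eigenvector split off costs
  -- at least `δ`.
  suffices H : ∀ (n : ℕ) (p a : E), ‖p‖ ^ 2 ≤ n * δ → IsIdem p → p * a = a →
      ∃ (s : Finset E) (c : E → ℝ), (∀ u ∈ s, IsAtomicIdem u ∧ p * u = u) ∧
      (∀ u ∈ s, ∀ v ∈ s, u ≠ v → u * v = 0) ∧ a = ∑ u ∈ s, c u • u by
    obtain ⟨n, hn⟩ := exists_nat_ge (‖(1 : E)‖ ^ 2 / δ)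
    obtain ⟨s, c, h1, h2, h3⟩ := H n 1 a ((div_le_iff₀ hδ).1 hn) (one_mul 1) (one_mul a)
    exact ⟨s, c, fun u hu => (h1 u hu).1, h2, h3⟩
  clear a
  intro n
  induction n with
  | zero =>
    intro p a hn hp ha
    have hp0 : p = 0 := by
      by_contra hp0
      have := hle p hp hp0
      simp only [Nat.cast_zero, zero_mul] at hn
      linarith
    refine ⟨∅, 0, by simp, by simp, ?_⟩
    rw [← ha, hp0, jzero_mul, Finset.sum_empty]
  | succ n ih =>
    intro p a hn hp ha
    rcases eq_or_ne p 0 with hp0 | hp0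
    · refine ⟨∅, 0, by simp, by simp, ?_⟩
      rw [← ha, hp0, jzero_mul, Finset.sum_empty]
    obtain ⟨r, u, hu, hpu, hau⟩ := exists_eigen_atomic hp hp0 ha
    have hpp : p * p = p := hp
    have huu : u * u = u := hu.1
    have hid := isIdem_sub hp hu.1 hpu
    have h1 := norm_sq_sub_idem hu.1 hpu
    have h2 := hle _ hu.1 hu.2.1
    push_cast at hn
    obtain ⟨s, c, hs, horth, hsum⟩ := ih (p - u) (a - r • u) (by linarith) hid (by
      simp only [jmul_sub, jsub_mul, mul_smul_comm, ha, hpu, mul_comm u a, hau, huu]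
      module)
    have hpu0 : (p - u) * u = 0 := by rw [jsub_mul, hpu, huu, sub_self]
    have hvu : ∀ v ∈ s, v * u = 0 := fun v hv => mul_eq_zero_of_peirce hid (hs v hv).2 hpu0
    have hus : u ∉ s := fun h => hu.2.1 (by rw [← huu, hvu u h])
    refine ⟨insert u s, Function.update c u r, ?_, ?_, ?_⟩
    · intro v hv
      rcases Finset.mem_insert.1 hv with rfl | hv
      · exact ⟨hu, hpu⟩
      · refine ⟨(hs v hv).1, ?_⟩
        have := (hs v hv).2
        rwa [jsub_mul, mul_comm u, hvu v hv, sub_zero] at this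
    · intro v hv w hw hvw
      rw [Finset.mem_insert] at hv hw
      rcases hv with rfl | hv
      · rcases hw with rfl | hw
        · exact absurd rfl hvw
        · rw [mul_comm, hvu w hw]
      · rcases hw with rfl | hw
        · exact hvu v hv
        · exact horth v hv w hw hvw
    · rw [Finset.sum_insert hus, Function.update_self, ← sub_eq_iff_eq_add', hsum]
      refine Finset.sum_congr rfl fun v hv => ?_
      rw [Function.update_of_ne]
      rintro rfl
      exact hus hv

theorem sum_mul_sum_orthogonal {ι : Type*} (s : Finset ι) (p : ι → E)
    (hp : ∀ i ∈ s, IsIdem (p i)) (ho : ∀ i ∈ s, ∀ j ∈ s, i ≠ j → p i * p j = 0) (c d : ι → ℝ) :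
    (∑ i ∈ s, c i • p i) * ∑ i ∈ s, d i • p i = ∑ i ∈ s, (c i * d i) • p i := by
  rw [jmul_sum]
  refine Finset.sum_congr rfl fun j hj => ?_
  rw [mul_comm, jmul_sum, Finset.sum_eq_single j]
  · have : p j * p j = p j := hp j hj
    rw [smul_mul_assoc, mul_smul_comm, this, smul_smul, mul_comm]
  · intro i hi hij
    rw [smul_mul_assoc, mul_smul_comm, ho j hj i hi hij.symm, smul_zero, smul_zero]
  · exact fun h => absurd hj h

theorem isPos_sum {ι : Type*} (s : Finset ι) (p : ι → E)
    (hp : ∀ i ∈ s, IsIdem (p i)) (ho : ∀ i ∈ s, ∀ j ∈ s, i ≠ j → p i * p j = 0) (c : ι → ℝ)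
    (hc : ∀ i ∈ s, 0 ≤ c i) : IsPos (∑ i ∈ s, c i • p i) := by
  refine ⟨∑ i ∈ s, Real.sqrt (c i) • p i, ?_⟩
  rw [sum_mul_sum_orthogonal s p hp ho]
  exact Finset.sum_congr rfl fun i hi => by rw [Real.mul_self_sqrt (hc i hi)]

theorem inner_sum_orthogonal {s : Finset E} {c : E → ℝ}
    (ho : ∀ u ∈ s, ∀ v ∈ s, u ≠ v → u * v = 0) {v : E} (hv : v ∈ s) :
    inner ℝ (∑ u ∈ s, c u • u) v = c v * ‖v‖ ^ 2 := by
  rw [sum_inner, Finset.sum_eq_single v]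
  · rw [inner_smul_left, real_inner_self_eq_norm_sq]; rfl
  · intro u hu huv
    rw [inner_smul_left, inner_eq_zero_of_mul_eq_zero (ho u hu v hv huv), mul_zero]
  · exact fun h => absurd hv h

theorem coef_nonneg {s : Finset E} {c : E → ℝ} (hs : ∀ u ∈ s, IsAtomicIdem u)
    (ho : ∀ u ∈ s, ∀ v ∈ s, u ≠ v → u * v = 0)
    (h : ∀ u, IsIdem u → 0 ≤ inner ℝ (∑ u ∈ s, c u • u) u) {v : E} (hv : v ∈ s) : 0 ≤ c v := by
  have h1 := h v (hs v hv).1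
  rw [inner_sum_orthogonal ho hv] at h1
  have : 0 < ‖v‖ ^ 2 := by have := norm_pos_iff.2 (hs v hv).2.1; positivity
  exact nonneg_of_mul_nonneg_left h1 this

/-- An element is positive iff its inner product with every idempotent is nonnegative. -/
theorem isPos_iff {a : E} : IsPos a ↔ ∀ u, IsIdem u → 0 ≤ inner ℝ a u := by
  refine ⟨fun h u hu => h.inner_idem_nonneg hu, fun h => ?_⟩
  obtain ⟨s, c, hs, ho, rfl⟩ := exists_spectral_decomposition a
  exact isPos_sum s id (fun u hu => (hs u hu).1) ho c fun v hv => coef_nonneg hs ho h hv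

theorem nonempty_spectralDecomposition {a : E} (ha : IsPos a) :
    Nonempty (SpectralDecomposition a) := by
  classical
  obtain ⟨s, c, hs, ho, rfl⟩ := exists_spectral_decomposition a
  have hc : ∀ v ∈ s, 0 ≤ c v := fun v hv => coef_nonneg hs ho (isPos_iff.1 ha) hv
  -- Zero coefficients are dropped, since `SpectralDecomposition` demands strict positivity.
  set t := s.filter fun v => c v ≠ 0 with ht
  have hts : ∀ v ∈ t, v ∈ s ∧ c v ≠ 0 := fun v hv => by simpa [ht] using hv
  let f := t.equivFin.symm
  refine ⟨⟨t.card, fun i => c (f i), fun i => f i, fun i => ?_, fun i => hs _ (hts _ (f i).2).1,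
    fun i j hij => ?_, ?_⟩⟩
  · exact lt_of_le_of_ne (hc _ (hts _ (f i).2).1) (hts _ (f i).2).2.symm
  · exact ho _ (hts _ (f i).2).1 _ (hts _ (f j).2).1
      fun h => hij (f.injective (Subtype.ext h))
  · rw [Equiv.sum_comp f (fun v : t => c v • (v : E)), Finset.sum_coe_sort t fun v => c v • v, ht]
    rw [Finset.sum_filter_of_ne]
    intro v _ h hcv
    exact h (by rw [hcv, zero_smul])

theorem exists_pos_neg_parts (a : E) :
    ∃ y m : E, IsPos y ∧ IsPos m ∧ a = y - m ∧ y * m = 0 := by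
  obtain ⟨s, c, hs, ho, rfl⟩ := exists_spectral_decomposition a
  have hi : ∀ u ∈ s, IsIdem (id u) := fun u hu => (hs u hu).1
  refine ⟨∑ u ∈ s, max (c u) 0 • id u, ∑ u ∈ s, max (-c u) 0 • id u,
    isPos_sum s id hi ho _ fun _ _ => le_max_right _ _,
    isPos_sum s id hi ho _ fun _ _ => le_max_right _ _, ?_, ?_⟩
  · rw [← Finset.sum_sub_distrib]
    refine Finset.sum_congr rfl fun u _ => ?_
    rw [← sub_smul]
    congr 1
    rcases le_total (c u) 0 with h | h
    · rw [max_eq_right h, max_eq_left (by linarith)]; ring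
    · rw [max_eq_left h, max_eq_right (by linarith)]; ring
  · rw [sum_mul_sum_orthogonal s id hi ho]
    refine Finset.sum_eq_zero fun u _ => ?_
    rcases le_total (c u) 0 with h | h
    · rw [max_eq_right h, zero_mul, zero_smul]
    · rw [max_eq_right (a := -c u) (by linarith), mul_zero, zero_smul]

theorem IsPos.inner_nonneg {a b : E} (ha : IsPos a) (hb : IsPos b) : 0 ≤ inner ℝ a b := by
  obtain ⟨s, c, hs, ho, rfl⟩ := exists_spectral_decomposition b
  rw [inner_sum]
  refine Finset.sum_nonneg fun u hu => ?_
  rw [inner_smul_right]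
  exact mul_nonneg (coef_nonneg hs ho (isPos_iff.1 hb) hu) (ha.inner_idem_nonneg (hs u hu).1)

/-- The unit is an order unit. -/
theorem exists_jLe_smul_one (b : E) : ∃ k : ℝ, 0 ≤ k ∧ JLe b (k • 1) := by
  obtain ⟨δ, hδ, hle⟩ := exists_le_norm_sq_idem E
  have hs := Real.sqrt_pos.2 hδ
  refine ⟨‖b‖ / Real.sqrt δ, by positivity, isPos_iff.2 fun u hu => ?_⟩
  rcases eq_or_ne u 0 with rfl | hu0
  · simp
  -- Then `⟪b, u⟫ ≤ ‖b‖‖u‖ ≤ (‖b‖/√δ)⟪1, u⟫`, because `‖u‖ ≥ √δ`.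
  have h1 : inner ℝ (1 : E) u = ‖u‖ ^ 2 := by
    have huu : u * u = u := hu
    rw [← real_inner_self_eq_norm_sq]
    nth_rewrite 1 [← huu]
    rw [← inner_mul_left, mul_one]
  rw [inner_sub_left, inner_smul_left, h1]
  have h2 := real_inner_le_norm b u
  have h3 : Real.sqrt δ ≤ ‖u‖ := Real.sqrt_le_iff.2 ⟨norm_nonneg _, hle u hu hu0⟩
  have h4 : ‖b‖ * ‖u‖ ≤ ‖b‖ / Real.sqrt δ * ‖u‖ ^ 2 := by
    rw [div_mul_eq_mul_div, le_div_iff₀ hs, pow_two, ← mul_assoc]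
    gcongr
  simp only [RCLike.conj_to_real]
  linarith

end Spectral

/-! ### Positivity and invertibility of quadratic maps -/

section Quadratic

variable {E : Type*} [NormedAddCommGroup E] [InnerProductSpace ℝ E] [EuclideanJordanAlgebra E]

/-- The resolvents of multiplication by an idempotent are positive. -/
theorem isPos_of_resolvent {p y : E} (hp : IsIdem p) {ε : ℝ} (hε : ε < 1)
    (h : IsPos (y - ε • (p * y))) : IsPos y := by
  obtain ⟨z, m, hz, hm, rfl, hzm⟩ := exists_pos_neg_parts y
  -- Pairing with the negative part `m` removes every term in `z` and leaves `‖m‖² ≤ ε⟪p * m, m⟫`,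
  -- where `0 ≤ ⟪p * m, m⟫ ≤ ‖m‖²`. Since `ε < 1`, this forces `m = 0`.
  have h1 := h.inner_nonneg hm
  have h2 : inner ℝ z m = 0 := inner_eq_zero_of_mul_eq_zero hzm
  have h3 : inner ℝ (p * z) m = 0 := by rw [inner_mul_comm, hzm, inner_zero_right]
  have h4 : 0 ≤ inner ℝ (p * m) m := by rw [inner_idem_mul hp]; positivity
  have h5 : 0 ≤ inner ℝ ((1 - p) * m) m := by
    rw [inner_idem_mul (isIdem_one_sub hp)]; positivity
  rw [jsub_mul, one_mul, inner_sub_left, real_inner_self_eq_norm_sq] at h5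
  simp only [jmul_sub, inner_sub_left, inner_smul_left, RCLike.conj_to_real, h2, h3,
    real_inner_self_eq_norm_sq] at h1
  have h6 : ‖m‖ ^ 2 ≤ 0 := by
    rcases le_total ε 0 with he | he
    · nlinarith
    · have : ε * inner ℝ (p * m) m ≤ ε * ‖m‖ ^ 2 := by
        gcongr; linarith
      have h7 : (1 - ε) * ‖m‖ ^ 2 ≤ 0 := by linarith
      nlinarith
  have hm0 : m = 0 := by
    rw [← norm_eq_zero, ← sq_eq_zero_iff]
    exact le_antisymm h6 (sq_nonneg _)
  rwa [hm0, sub_zero]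

theorem isPos_of_tendsto {f : ℕ → E} {a : E} (hf : ∀ᶠ n in Filter.atTop, IsPos (f n))
    (h : Filter.Tendsto f Filter.atTop (nhds a)) : IsPos a :=
  isPos_iff.2 fun _ hu => ge_of_tendsto (h.inner tendsto_const_nhds)
    (hf.mono fun _ hn => hn.inner_idem_nonneg hu)

/-- Rescaling the Peirce components of a positive element by `1`, `c` and `c²` with `c > 0`
gives a positive element. -/
theorem isPos_peirce_scaling {p x y z : E} (hp : IsIdem p) (hx : p * x = 0)
    (hy : p * y = (1 / 2 : ℝ) • y) (hz : p * z = z) (h : IsPos (x + y + z)) {c : ℝ} (hc : 0 < c) :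
    IsPos (x + c • y + c ^ 2 • z) := by
  -- These are the powers `(1 - ε L p)⁻ⁿ`. With `ε = 2τ/n` and `τ = log c` they tend to `exp (2τ L
  -- p)`, whose eigenvalues are `1`, `c` and `c²`.
  have hpow : ∀ ε : ℝ, ε < 1 → ∀ n : ℕ,
      IsPos (x + ((1 - ε / 2) ^ n)⁻¹ • y + ((1 - ε) ^ n)⁻¹ • z) := by
    intro ε hε n
    have h1 : 1 - ε ≠ 0 := by linarith
    have h2 : 1 - ε / 2 ≠ 0 := by linarith
    induction n with
    | zero => simpa using h
    | succ n ih =>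
      refine isPos_of_resolvent hp hε ?_
      convert ih using 1
      simp only [mul_add, mul_smul_comm, hx, hy, hz]
      have e1 : ((1 - ε / 2) ^ n)⁻¹ = ((1 - ε / 2) ^ (n + 1))⁻¹ * (1 - ε / 2) := by
        rw [pow_succ, mul_inv, inv_mul_cancel_right₀ h2]
      have e2 : ((1 - ε) ^ n)⁻¹ = ((1 - ε) ^ (n + 1))⁻¹ * (1 - ε) := by
        rw [pow_succ, mul_inv, inv_mul_cancel_right₀ h1]
      rw [e1, e2]
      module
  set τ := Real.log c with hτ
  have lim : ∀ t : ℝ, Filter.Tendsto (fun n : ℕ => ((1 - t / n) ^ n)⁻¹) Filter.atTop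
      (nhds (Real.exp t)) := by
    intro t
    have := (Real.tendsto_one_add_div_pow_exp (-t)).inv₀ (Real.exp_ne_zero _)
    rw [← Real.exp_neg, neg_neg] at this
    refine this.congr fun n => ?_
    rw [neg_div, sub_eq_add_neg]
  have hexp : Real.exp τ = c := Real.exp_log hc
  have hexp2 : Real.exp (2 * τ) = c ^ 2 := by
    rw [two_mul, Real.exp_add, hexp, pow_two]
  have h0 : Filter.Tendsto (fun n : ℕ => 2 * τ / (n : ℝ)) Filter.atTop (nhds 0) :=
    tendsto_const_div_atTop_nhds_zero_nat _
  rw [← hexp2, ← hexp]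
  refine isPos_of_tendsto (f := fun n : ℕ =>
    x + ((1 - τ / n) ^ n)⁻¹ • y + ((1 - 2 * τ / n) ^ n)⁻¹ • z) ?_
    ((tendsto_const_nhds.add ((lim τ).smul_const y)).add ((lim (2 * τ)).smul_const z))
  filter_upwards [h0.eventually_lt_const one_pos] with n hn
  have := hpow _ hn n
  rwa [show 2 * τ / (n : ℝ) / 2 = τ / n by ring] at this

theorem Q_one_add_smul_apply {p : E} (hp : IsIdem p) (t : ℝ) (x : E) :
    Q (1 + t • p) x = x + (2 * t - t ^ 2) • (p * x) + (2 * t ^ 2) • (p * (p * x)) := by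
  have hpp : p * p = p := hp
  rw [Q_apply]
  simp only [mul_add, add_mul, mul_one, one_mul, smul_mul_assoc, mul_smul_comm, hpp]
  module

theorem isPos_Q_one_add_smul {p x : E} (hp : IsIdem p) {t : ℝ} (ht : 0 < 1 + t) (hx : IsPos x) :
    IsPos (Q (1 + t • p) x) := by
  have h3 := mul_mul_idem hp x
  -- The Peirce projections are the Lagrange polynomials in `L p` at `0`, `1/2` and `1`; `Q (1 + t •
  -- p)` scales them by `1`, `1 + t` and `(1 + t)²`.
  have h := isPos_peirce_scaling (p := p) (x := x - (3 : ℝ) • (p * x) + (2 : ℝ) • (p * (p * x)))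
    (y := (4 : ℝ) • (p * x) - (4 : ℝ) • (p * (p * x)))
    (z := (2 : ℝ) • (p * (p * x)) - p * x) hp
    (by simp only [mul_add, jmul_sub, mul_smul_comm, h3]; module)
    (by simp only [jmul_sub, mul_smul_comm, h3]; module)
    (by simp only [jmul_sub, mul_smul_comm, h3]; module)
    (by convert hx using 1; module) ht
  rw [Q_one_add_smul_apply hp]
  convert h using 1
  module

theorem Q_one_add_smul_inv {p : E} (hp : IsIdem p) {t s : ℝ} (h : (1 + t) * (1 + s) = 1) (x : E) :
    Q (1 + t • p) (Q (1 + s • p) x) = x := by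
  have h3 := mul_mul_idem hp x
  rw [Q_one_add_smul_apply hp, Q_one_add_smul_apply hp]
  simp only [mul_add, mul_smul_comm, mul_mul_idem hp, jmul_sub]
  have e : s + t + t * s = 0 := by linarith
  match_scalars
  · rfl
  · linear_combination (2 - (s + t + t * s)) * e
  · linear_combination 2 * (s + t + t * s) * e

theorem idem_mul_comm_of_orthogonal {p r : E} (hp : IsIdem p) (hr : p * r = 0) (x : E) :
    r * (p * x) = p * (r * x) := by
  have h := jordan_linearized r p p x
  have hpp : p * p = p := hp
  simp only [mul_comm r p, hr, hpp, jzero_mul, jmul_zero, sub_zero, add_zero] at h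
  exact sub_eq_zero.1 h

theorem mul_sq_eq_zero_of_orthogonal {p r : E} (hp : IsIdem p) (hr : p * r = 0) :
    p * (r * r) = 0 := by
  have hv := isIdem_one_sub hp
  have h : r ∈ peirceOne (1 - p) := by
    rw [mem_peirceOne_iff hv, jsub_mul, one_mul, hr, sub_zero]
  have := (mem_peirceOne_iff hv _).1 (mul_mem_peirceOne hv h h)
  rw [jsub_mul, one_mul] at this
  simpa using this

/-- `L r` kills the Peirce one-space of `p` and preserves the others, so `p * (r * x)` lies in the
half-space. -/
theorem mul_idem_idem_mul {p r : E} (hp : IsIdem p) (hr : p * r = 0) (x : E) :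
    p * (p * (r * x)) = (1 / 2 : ℝ) • (p * (r * x)) := by
  have h := jordan_linearized p p x r
  have hpp : p * p = p := hp
  have hc := idem_mul_comm_of_orthogonal hp hr
  simp only [hpp, hr, mul_comm x, mul_comm _ r, jmul_zero, jzero_mul, hc] at h
  rw [← sub_eq_zero]
  refine Eq.trans ?_ ((congrArg ((1 / 2 : ℝ) • ·) h).trans (smul_zero _))
  module

/-- Only the half-space of `p` contributes, and there `2 L r` squares to `2 L (r * r)`. -/
theorem idem_mul_mul_mul {p r : E} (hp : IsIdem p) (hr : p * r = 0) (x : E) :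
    p * (r * (r * x)) = (1 / 2 : ℝ) • (p * (r * r * x)) := by
  have h := jordan_linearized r r x p
  have hc := idem_mul_comm_of_orthogonal hp hr
  have hr2 := mul_sq_eq_zero_of_orthogonal hp hr
  have hc2 := idem_mul_comm_of_orthogonal hp hr2
  simp only [hr, hr2, mul_comm x, mul_comm _ p, jmul_zero, jzero_mul, hc, hc2] at h
  rw [← sub_eq_zero]
  refine Eq.trans ?_ ((congrArg ((1 / 2 : ℝ) • ·) h).trans (smul_zero _))
  module

/-- Here `1 + r + t • p = (1 + r) * (1 + t • p)`. Both orders of the factors are needed so that, in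
a product with the inverse, the `p`-factors meet and cancel. -/
theorem Q_one_add_add_smul {p r : E} (hp : IsIdem p) (hr : p * r = 0) (t : ℝ) (x : E) :
    Q (1 + r + t • p) x = Q (1 + r) (Q (1 + t • p) x) ∧
      Q (1 + r + t • p) x = Q (1 + t • p) (Q (1 + r) x) := by
  have hpp : p * p = p := hp
  have hc := idem_mul_comm_of_orthogonal hp hr
  have hc2 := idem_mul_comm_of_orthogonal hp (mul_sq_eq_zero_of_orthogonal hp hr)
  have h1 := mul_idem_idem_mul hp hr
  have h1' := mul_idem_idem_mul hp (mul_sq_eq_zero_of_orthogonal hp hr)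
  have h2 := idem_mul_mul_mul hp hr
  rw [Q_one_add_smul_apply hp, Q_one_add_smul_apply hp]
  simp only [Q_apply, mul_add, add_mul, jmul_sub, mul_one, one_mul, smul_mul_assoc,
    mul_smul_comm, hpp, mul_comm r p, hr, hc, hc2, h1, h1', h2, smul_zero, jzero_mul]
  constructor <;> module

/-- Invertible combinations of orthogonal idempotents act positively and invertibly. -/
theorem Q_one_add_sum {ι : Type*} (s : Finset ι) (p : ι → E)
    (hp : ∀ i ∈ s, IsIdem (p i)) (ho : ∀ i ∈ s, ∀ j ∈ s, i ≠ j → p i * p j = 0) (a : ι → ℝ)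
    (ha : ∀ i ∈ s, 0 < a i) :
    (∀ x, IsPos x → IsPos (Q (1 + ∑ i ∈ s, (a i - 1) • p i) x)) ∧
    ∀ x, Q (1 + ∑ i ∈ s, (a i - 1) • p i) (Q (1 + ∑ i ∈ s, ((a i)⁻¹ - 1) • p i) x) = x := by
  classical
  induction s using Finset.induction_on with
  | empty =>
    have h : ∀ x : E, Q (1 + 0) x = x := fun x => by
      rw [Q_apply]
      simp only [add_zero, one_mul]
      module
    simp only [Finset.sum_empty]
    exact ⟨fun x hx => by rwa [h], fun x => by rw [h, h]⟩
  | insert j s hj ih =>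
    obtain ⟨h1, h2⟩ := ih (fun i hi => hp i (Finset.mem_insert_of_mem hi))
      (fun i hi k hk => ho i (Finset.mem_insert_of_mem hi) k (Finset.mem_insert_of_mem hk))
      fun i hi => ha i (Finset.mem_insert_of_mem hi)
    have hjs := Finset.mem_insert_self j s
    have hpj := hp j hjs
    have haj := ha j hjs
    have hz : ∀ c : ι → ℝ, p j * ∑ i ∈ s, c i • p i = 0 := by
      intro c
      rw [jmul_sum]
      refine Finset.sum_eq_zero fun i hi => ?_
      rw [mul_smul_comm, ho j hjs i (Finset.mem_insert_of_mem hi), smul_zero]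
      rintro rfl
      exact hj hi
    have hsum : ∀ c : ι → ℝ, 1 + ∑ i ∈ insert j s, c i • p i
        = 1 + ∑ i ∈ s, c i • p i + c j • p j := by
      intro c
      rw [Finset.sum_insert hj]
      abel
    rw [hsum fun i => a i - 1, hsum fun i => (a i)⁻¹ - 1]
    refine ⟨fun x hx => ?_, fun x => ?_⟩
    · rw [(Q_one_add_add_smul hpj (hz _) _ _).1]
      exact h1 _ (isPos_Q_one_add_smul hpj (by linarith) hx)
    · rw [(Q_one_add_add_smul hpj (hz _) _ _).1, (Q_one_add_add_smul hpj (hz _) _ _).2,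
        Q_one_add_smul_inv hpj (by rw [add_sub_cancel, add_sub_cancel, mul_inv_cancel₀ haj.ne']),
        h2]

end Quadratic

/-! ### The filter property -/

section Filter

variable {E : Type*} [NormedAddCommGroup E] [InnerProductSpace ℝ E] [EuclideanJordanAlgebra E]

theorem Q_mem_peirceOne {p a x : E} (hp : IsIdem p) (ha : a ∈ peirceOne p) (hx : x ∈ peirceOne p) :
    Q a x ∈ peirceOne p :=
  Submodule.sub_mem _
    (Submodule.smul_mem _ _ (mul_mem_peirceOne hp ha (mul_mem_peirceOne hp ha hx)))
    (mul_mem_peirceOne hp (mul_mem_peirceOne hp ha ha) hx)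

/-- `1 - p` annihilates `E₁(p)`. This carries results about elements invertible in `E` over to
elements invertible only in the corner. -/
theorem Q_one_sub_add {p a x : E} (hp : IsIdem p) (ha : a ∈ peirceOne p) (hx : x ∈ peirceOne p) :
    Q (1 - p + a) x = Q a x := by
  have hax := (mem_peirceOne_iff hp _).1 (mul_mem_peirceOne hp ha hx)
  rw [mem_peirceOne_iff hp] at ha hx
  have hpp : p * p = p := hp
  rw [Q_apply, Q_apply]
  simp only [mul_add, add_mul, jmul_sub, jsub_mul, mul_one, one_mul, mul_comm a p, hpp, ha, hx, hax]
  module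

/-- Idempotents of the corner are idempotents of `E`, and they suffice to test positivity in the
corner. -/
theorem isPos_peirceOne_iff {p : E} (hp : IsIdem p) (x : peirceOne p) :
    @IsPos _ _ _ (peirceOneAlgebra p hp) x ↔ IsPos (x : E) := by
  let _ := peirceOneAlgebra p hp
  refine ⟨fun ⟨b, hb⟩ => ⟨b, congrArg Subtype.val hb⟩, fun h => isPos_iff.2 fun u hu => ?_⟩
  exact h.inner_idem_nonneg (u := (u : E)) (congrArg Subtype.val hu)

theorem isPos_filterSpace_iff {q : E} (x : filterSpace q) : IsPos x ↔ IsPos (x : E) :=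
  isPos_peirceOne_iff (isIdem_ceil q) x

namespace SpectralDecomposition

variable {q : E} (d : SpectralDecomposition q)

theorem idem (i : Fin d.n) : IsIdem (d.proj i) := (d.atomic i).1

theorem sum_mul_sum (c e : Fin d.n → ℝ) :
    (∑ i, c i • d.proj i) * ∑ i, e i • d.proj i = ∑ i, (c i * e i) • d.proj i :=
  sum_mul_sum_orthogonal _ _ (fun i _ => d.idem i) (fun i _ j _ => d.orthogonal i j) c e

theorem sum_proj_eq : ∑ i, d.proj i = ∑ i, (1 : ℝ) • d.proj i := by simp only [one_smul]

theorem isIdem_sum : IsIdem (∑ i, d.proj i) := by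
  unfold IsIdem
  rw [d.sum_proj_eq, d.sum_mul_sum]
  simp only [mul_one]

theorem sum_mem (c : Fin d.n → ℝ) : ∑ i, c i • d.proj i ∈ peirceOne (∑ i, d.proj i) := by
  rw [mem_peirceOne_iff d.isIdem_sum, d.sum_proj_eq, d.sum_mul_sum]
  simp only [one_mul]

theorem Q_one_add_sum_apply (c : Fin d.n → ℝ) {x : E} (hx : x ∈ peirceOne (∑ i, d.proj i)) :
    Q (1 + ∑ i, (c i - 1) • d.proj i) x = Q (∑ i, c i • d.proj i) x := by
  rw [← Q_one_sub_add d.isIdem_sum (d.sum_mem c) hx]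
  congr 2
  simp only [sub_smul, one_smul, Finset.sum_sub_distrib]
  abel

theorem isPos_Q {c : Fin d.n → ℝ} (hc : ∀ i, 0 < c i) {x : E}
    (hx : x ∈ peirceOne (∑ i, d.proj i)) (h : IsPos x) : IsPos (Q (∑ i, c i • d.proj i) x) := by
  rw [← d.Q_one_add_sum_apply c hx]
  exact (Q_one_add_sum _ _ (fun i _ => d.idem i) (fun i _ j _ => d.orthogonal i j) c
    fun i _ => hc i).1 x h

theorem Q_Q_inv {c : Fin d.n → ℝ} (hc : ∀ i, 0 < c i) {x : E}
    (hx : x ∈ peirceOne (∑ i, d.proj i)) :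
    Q (∑ i, c i • d.proj i) (Q (∑ i, (c i)⁻¹ • d.proj i) x) = x := by
  rw [← d.Q_one_add_sum_apply c (Q_mem_peirceOne d.isIdem_sum (d.sum_mem _) hx),
    ← d.Q_one_add_sum_apply (fun i => (c i)⁻¹) hx]
  exact (Q_one_add_sum _ _ (fun i _ => d.idem i) (fun i _ j _ => d.orthogonal i j) c
    fun i _ => hc i).2 x

theorem Q_inv_Q {c : Fin d.n → ℝ} (hc : ∀ i, 0 < c i) {x : E}
    (hx : x ∈ peirceOne (∑ i, d.proj i)) :
    Q (∑ i, (c i)⁻¹ • d.proj i) (Q (∑ i, c i • d.proj i) x) = x := by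
  simpa only [inv_inv] using d.Q_Q_inv (fun i => inv_pos.2 (hc i)) hx

theorem Q_sum_proj (c : Fin d.n → ℝ) :
    Q (∑ i, c i • d.proj i) (∑ i, d.proj i) = ∑ i, c i ^ 2 • d.proj i := by
  rw [Q_apply, d.sum_proj_eq]
  simp only [d.sum_mul_sum, mul_one, pow_two]
  module

end SpectralDecomposition

/-- The square root and the ceiling of a positive element arise from a common decomposition. -/
theorem exists_decomposition_sqrt_ceil {q : E} (hq : IsPos q) :
    ∃ d : SpectralDecomposition q, sqrt q = ∑ i, Real.sqrt (d.coef i) • d.proj i ∧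
      ceil q = ∑ i, d.proj i := by
  have h := nonempty_spectralDecomposition hq
  exact ⟨h.some, dif_pos h, dif_pos h⟩

theorem isPos_of_isEffect {q : E} (hq : IsEffect q) : IsPos q := by
  have := hq.1
  unfold JLe at this
  rwa [sub_zero] at this

section Map

variable {F : Type*} [NormedAddCommGroup F] [InnerProductSpace ℝ F] [EuclideanJordanAlgebra F]

/-- The values of a positive map are bounded by multiples of its value at the unit. -/
theorem exists_jLe_smul_map_one {f : F →ₗ[ℝ] E} (hf : ∀ a, IsPos a → IsPos (f a)) (b : F) :
    ∃ k : ℝ, 0 ≤ k ∧ JLe (f b) (k • f 1) := by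
  obtain ⟨k, hk, h⟩ := exists_jLe_smul_one b
  refine ⟨k, hk, ?_⟩
  have := hf _ h
  rwa [map_sub, map_smul] at this

/-- A positive map with value at the unit below an element of `E₁(p)` has values in `E₁(p)`. -/
theorem map_mem_peirceOne {f : F →ₗ[ℝ] E} (hf : ∀ a, IsPos a → IsPos (f a)) {p q : E}
    (hp : IsIdem p) (hq : p * q = q) (hfq : JLe (f 1) q) (b : F) : f b ∈ peirceOne p := by
  have hv := isIdem_one_sub hp
  have hqv : inner ℝ q (1 - p) = 0 :=
    inner_eq_zero_of_mul_eq_zero (by rw [jmul_sub, mul_one, mul_comm, hq, sub_self])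
  have key : ∀ b, IsPos b → f b ∈ peirceOne p := by
    intro b hb
    -- From `f b ≤ k • f 1`, `f 1 ≤ q` and `⟪q, 1 - p⟫ = 0`, the positive element `f b` pairs
    -- nonpositively with `1 - p`, hence is annihilated by it.
    obtain ⟨k, hk, h⟩ := exists_jLe_smul_map_one hf b
    have h1 := h.inner_idem_nonneg hv
    have h2 := hfq.inner_idem_nonneg hv
    simp only [inner_sub_left, inner_smul_left, RCLike.conj_to_real, hqv] at h1 h2
    have h3 := (hf b hb).mul_eq_zero hv (by nlinarith)
    rw [jsub_mul, one_mul, sub_eq_zero] at h3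
    exact (mem_peirceOne_iff hp _).2 h3.symm
  obtain ⟨y, m, hy, hm, rfl, -⟩ := exists_pos_neg_parts b
  rw [map_sub]
  exact Submodule.sub_mem _ (key y hy) (key m hm)

end Map

theorem isFilterFor_standardFilter {E : Type u} [NormedAddCommGroup E] [InnerProductSpace ℝ E]
    [EuclideanJordanAlgebra E] {q : E} (hq : IsEffect q) :
    IsFilterFor.{u, u, w} q (standardFilter q) := by
  obtain ⟨d, hs, hc⟩ := exists_decomposition_sqrt_ceil (isPos_of_isEffect hq)
  have hpos : ∀ i, 0 < Real.sqrt (d.coef i) := fun i => Real.sqrt_pos.2 (d.coef_pos i)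
  have hfs : filterSpace q = peirceOne (∑ i, d.proj i) := by rw [← hc]; rfl
  have hmem : ∀ x : filterSpace q, (x : E) ∈ peirceOne (∑ i, d.proj i) := fun x => hfs ▸ x.2
  have hξ : ∀ x : filterSpace q,
      standardFilter q x = Q (∑ i, Real.sqrt (d.coef i) • d.proj i) (x : E) := fun x => by
    rw [← hs]; rfl
  have hone : ((1 : filterSpace q) : E) = ∑ i, d.proj i := hc
  have hQone : Q (∑ i, Real.sqrt (d.coef i) • d.proj i) (∑ i, d.proj i) = q := by
    rw [d.Q_sum_proj]
    conv_rhs => rw [d.sum_eq]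
    exact Finset.sum_congr rfl fun i _ => by rw [Real.sq_sqrt (d.coef_pos i).le]
  have hξ1 : standardFilter q 1 = q := by rw [hξ, hone, hQone]
  have hpq : (∑ i, d.proj i) * q = q := by
    rw [← mem_peirceOne_iff d.isIdem_sum]
    have h := d.sum_mem d.coef
    rwa [← d.sum_eq] at h
  refine ⟨⟨fun x hx => ?_, by rw [hξ1]; exact hq.2⟩, ?_, ?_⟩
  · rw [hξ]
    exact d.isPos_Q hpos (hmem x) ((isPos_filterSpace_iff x).1 hx)
  · rw [hξ1]
    exact ⟨0, by rw [sub_self, jmul_zero]⟩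
  · intro F _ _ _ f hf hfq
    have hfm := map_mem_peirceOne hf.1 d.isIdem_sum hpq hfq
    -- The inverse of `√q` in `E_q`.
    set B : E := ∑ i, (Real.sqrt (d.coef i))⁻¹ • d.proj i with hB
    have hBm : B ∈ peirceOne (∑ i, d.proj i) := d.sum_mem _
    have hposB : ∀ x ∈ peirceOne (∑ i, d.proj i), IsPos x → IsPos (Q B x) :=
      fun x hx h => d.isPos_Q (fun i => inv_pos.2 (hpos i)) hx h
    let g : F →ₗ[ℝ] filterSpace q := (Q B ∘ₗ f).codRestrict (filterSpace q) fun b => by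
      rw [hfs]
      exact Q_mem_peirceOne d.isIdem_sum hBm (hfm b)
    have hg : ∀ b, (g b : E) = Q B (f b) := fun b => rfl
    refine ⟨g, ⟨⟨fun b hb => ?_, ?_⟩, ?_⟩, ?_⟩
    · rw [isPos_filterSpace_iff, hg]
      exact hposB _ (hfm b) (hf.1 b hb)
    · unfold JLe
      rw [isPos_filterSpace_iff, Submodule.coe_sub, hone, hg]
      -- The unit of `E_q` is `Q B q`, so `1 - g 1 = Q B (q - f 1)` is positive.
      have h1 : ∑ i, d.proj i = Q B q := by
        have h := d.Q_inv_Q hpos ((mem_peirceOne_iff d.isIdem_sum _).2 d.isIdem_sum)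
        rw [hQone] at h
        exact h.symm
      rw [h1, ← map_sub]
      exact hposB _ (Submodule.sub_mem _ ((mem_peirceOne_iff d.isIdem_sum _).2 hpq) (hfm 1)) hfq
    · ext b
      rw [LinearMap.comp_apply, hξ, hg]
      exact d.Q_Q_inv hpos (hfm b)
    · rintro g' ⟨-, hg'⟩
      ext b
      rw [hg, ← hg', LinearMap.comp_apply, hξ]
      exact (d.Q_inv_Q hpos (hmem (g' b))).symm

end Filter

end EuclideanJordanAlgebra

theorem mainTheorem6 {E : Type u} [NormedAddCommGroup E] [InnerProductSpace ℝ E]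
    [EuclideanJordanAlgebra E] (q : E) (hq : EuclideanJordanAlgebra.IsEffect q) :
    Nonempty (EuclideanJordanAlgebra.SpectralDecomposition q) ∧
      EuclideanJordanAlgebra.IsFilterFor.{u, u, w} q
        (EuclideanJordanAlgebra.standardFilter q) :=
  ⟨EuclideanJordanAlgebra.nonempty_spectralDecomposition
      (EuclideanJordanAlgebra.isPos_of_isEffect hq),
    EuclideanJordanAlgebra.isFilterFor_standardFilter hq⟩
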